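/- Theorem 4.1. Let $\mathcal{C}_n(\rho^{(1)},\rho^{(2)},\dots)$ be the set of permutations of $\{1,\dots,n\}$ that consist of a single cycle of length $n$ and whose one-line notation avoids each of the patterns $\rho^{(1)},\rho^{(2)},\dots$ (that is, has no subsequence whose entries are in the same relative order as the entries of some $\rho^{(i)}$), and let $\mu$ be the Möbius function. For $n\ge 2$, $$|\mathcal{C}_n(213,312)|=|\mathcal{C}_n(132,231)|=\frac{1}{2n}\sum_{\substack{d\mid n\\ d\text{ odd}}}\mu(d)\,2^{n/d},$$ $$|\mathcal{C}_n(321,2143,3142)|=\frac1n\sum_{d\mid n}\mu(d)\,2^{n/d}.$$ For $n\ge 3$, $$|\mathcal{C}_n(123,2413,3412)|=\begin{cases}\displaystyle \frac1n\sum_{d\mid n}\mu(d)\,2^{n/d} & \text{if } n\not\equiv 2\pmod 4,\\[2ex] \displaystyle \frac1n\sum_{d\mid n}\mu(d)\,2^{n/d}+\frac2n\sum_{d\mid \frac n2}\mu(d)\,2^{n/(2d)} & \text{if } n\equiv 2\pmod 4,\end{cases}$$ and $|\mathcal{C}_2(123,2413,3412)|=1$. -/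

import Mathlib

namespace PatternCycles

/-- The permutation `τ` contains the pattern `ρ`, a permutation given as the list of its entries
in one-line notation: some subsequence of the one-line notation of `τ` has its entries in the same
relative order as those of `ρ`. -/
def Contains {n : ℕ} (τ : Equiv.Perm (Fin n)) (ρ : List ℕ) : Prop :=
  ∃ f : Fin ρ.length → Fin n, StrictMono f ∧
    ∀ i j : Fin ρ.length, τ (f i) < τ (f j) ↔ ρ.get i < ρ.get j

/-- `cyclesAvoiding n P` is the set of cyclic permutations of an `n`-element chain (permutations
consisting of a single cycle through all the elements) that avoid every pattern in the list `P`. -/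
def cyclesAvoiding (n : ℕ) (P : List (List ℕ)) : Set (Equiv.Perm (Fin n)) :=
  {τ | τ.IsCycleOn Set.univ ∧ ∀ ρ ∈ P, ¬ Contains τ ρ}

end PatternCycles

/-!
Each of the pattern classes consists of the permutations `τ` that are monotone on an initial and on
a final block of positions: avoiding `213` and `312` means increasing and then decreasing; avoiding
`321`, `2143` and `3142` means having at most one descent; avoiding `123`, `2413` and `3412` means
having at most one ascent. The class of `132` and `231` is conjugate to the first one by the
reversal of `Fin n`.

Label the two blocks `false` and `true` by a map `g`, with directions given by `e : Bool → Bool`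
(`true` for decreasing). If `τ` is cyclic, the labels met along the orbit of a point `x` form a
binary sequence of period `n`, the itinerary of `x`. Two facts relate triples `(τ, g, x)` to words.

* Points are ordered like their itineraries in the lexicographic order twisted by `e`
  (`IsSplit.lt_of_key_lt`). Hence an aperiodic word comes from exactly one triple: the rotations of
  the word, sorted in this order, are permuted by the shift in the required way
  (`injOn_word`, `surjOn_word`).
* If the itinerary of `x` has period `r`, then `τ ^ r` maps the points with this itinerary to
  themselves, increasingly if a period contains an even number of decreasing letters, and then
  `n ∣ r` since an increasing map with a periodic point fixes it (`IsSplit.dvd_of_even`).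
  So an itinerary is aperiodic or the square of a word with an odd number of decreasing letters.

For two increasing blocks there are no such squares, and `τ` determines `g`, so that `n` times the
number of permutations is the number of aperiodic words (`ncard_descents`). For an increasing and a
decreasing block, the maximum can be put into either block; choosing the one that makes the number
of labels `true` odd gives a bijection with the aperiodic words with an odd number of letters `true`
(`ncard_valley`). For two decreasing blocks, squares of words of odd length `m` occur, when
`n = 2 * m`; each of them belongs to two triples, since the order of the points number `0` and `m`
of the orbit is arbitrary and decides all other comparisons left open by the word
(`injOn_word_lt`, `surjOn_word_lt`). This is the origin of the additional sum for
`n ≡ 2 (mod 4)`. Finally, aperiodic words are counted by Möbius inversion (`aperiodicCount_eq`,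
`two_mul_oddAperiodicCount_eq`).
-/

namespace PatternCycles

open Equiv Equiv.Perm Function

section Sequences

/-! ### Binary sequences and their signed lexicographic order -/

/-- The shift map on binary sequences. -/
def shift (w : ℕ → Bool) : ℕ → Bool := fun t => w (t + 1)

lemma iterate_shift (r : ℕ) (w : ℕ → Bool) (t : ℕ) : shift^[r] w t = w (t + r) := by
  induction r generalizing w with
  | zero => rfl
  | succ r ih => rw [Function.iterate_succ_apply, ih, shift, add_assoc]

/-- The comparison `x < y`, reversed when `b` is `true`. -/
def Oriented {α : Type*} [LT α] (b : Bool) (x y : α) : Prop := if b then y < x else x < y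

@[simp] lemma oriented_true {α : Type*} [LT α] {x y : α} : Oriented true x y ↔ y < x := by
  simp [Oriented]

@[simp] lemma oriented_false {α : Type*} [LT α] {x y : α} : Oriented false x y ↔ x < y := by
  simp [Oriented]

/-- The position, among the `2 ^ N` binary words of length `N`, of the prefix of `w` of length `N`
in the signed lexicographic order: letters are compared as `false < true`, but each common letter
`a` with `e a = true` reverses the order of what comes after it. -/
def key (e : Bool → Bool) : ℕ → (ℕ → Bool) → ℕ
  | 0, _ => 0
  | N + 1, w => (if w 0 then 2 ^ N else 0) +
      (if e (w 0) then 2 ^ N - 1 - key e N (shift w) else key e N (shift w))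

variable {e : Bool → Bool} {u v w : ℕ → Bool} {n N : ℕ}

lemma key_lt_two_pow (e : Bool → Bool) (N : ℕ) (w : ℕ → Bool) : key e N w < 2 ^ N := by
  induction N generalizing w with
  | zero => simp [key]
  | succ N ih =>
    have := ih (shift w)
    rw [key, pow_succ]
    split_ifs <;> omega

lemma key_succ_lt_of_lt (hu : u 0 = false) (hv : v 0 = true) :
    key e (N + 1) u < key e (N + 1) v := by
  have h1 := key_lt_two_pow e N (shift u)
  have h2 := key_lt_two_pow e N (shift v)
  simp only [key, hu, hv, if_true]
  split_ifs <;> simp_all <;> omega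

lemma key_succ_lt_iff (h : u 0 = v 0) :
    key e (N + 1) u < key e (N + 1) v ↔
      Oriented (e (u 0)) (key e N (shift u)) (key e N (shift v)) := by
  have h1 := key_lt_two_pow e N (shift u)
  have h2 := key_lt_two_pow e N (shift v)
  simp only [key, ← h, Oriented]
  split_ifs <;> omega

/-- A comparison decided by the first `N` letters is not affected by further letters. -/
lemma key_lt_succ (h : key e N u < key e N v) : key e (N + 1) u < key e (N + 1) v := by
  induction N generalizing u v with
  | zero => simp [key] at h
  | succ N ih =>
    by_cases h0 : u 0 = v 0
    · rw [key_succ_lt_iff h0] at h ⊢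
      cases hb : e (u 0)
      · rw [hb, oriented_false] at h
        exact oriented_false.2 (ih h)
      · rw [hb, oriented_true] at h
        exact oriented_true.2 (ih h)
    · cases hu : u 0
      · exact key_succ_lt_of_lt hu (by rw [hu] at h0; simpa using Ne.symm h0)
      · have hv : v 0 = false := by rw [hu] at h0; simpa using Ne.symm h0
        exact absurd h (key_succ_lt_of_lt hv hu).asymm

lemma eq_of_key_eq (h : key e N u = key e N v) : ∀ t < N, u t = v t := by
  induction N generalizing u v with
  | zero => simp
  | succ N ih =>
    have h0 : u 0 = v 0 := by
      cases hu : u 0 <;> cases hv : v 0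
      · rfl
      · exact absurd h (key_succ_lt_of_lt hu hv).ne
      · exact absurd h (key_succ_lt_of_lt hv hu).ne'
      · rfl
    have hs : key e N (shift u) = key e N (shift v) := by
      have h1 := mt (key_succ_lt_iff (e := e) (N := N) h0).2 h.not_lt
      have h2 := mt (key_succ_lt_iff (e := e) (N := N) h0.symm).2 h.symm.not_lt
      rw [← h0] at h2
      cases hb : e (u 0) <;> simp only [hb, oriented_false, oriented_true] at h1 h2 <;> omega
    intro t ht
    cases t with
    | zero => exact h0
    | succ t => exact ih hs t (by omega)

/-- Shifting compares sequences by the same number of letters: dropping a common first letter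
costs one letter of the prefix, which `key_lt_succ` makes up for. -/
lemma oriented_key_shift (h0 : u 0 = v 0) (h : key e N u < key e N v) :
    Oriented (e (u 0)) (key e N (shift u)) (key e N (shift v)) :=
  (key_succ_lt_iff h0).1 (key_lt_succ h)

/-- The first letters of two sequences are weakly ordered like the sequences. -/
lemma apply_zero_le_of_key_le (hn : 0 < n) (h : key e n u ≤ key e n v) : u 0 ≤ v 0 := by
  obtain ⟨N, rfl⟩ : ∃ N, n = N + 1 := ⟨n - 1, by omega⟩
  cases hu : u 0
  · simp
  · cases hv : v 0
    · exact absurd h (key_succ_lt_of_lt hv hu).not_ge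
    · exact le_rfl

/-! ### Periodic sequences -/

lemma apply_mod (hw : Function.IsPeriodicPt shift n w) (t : ℕ) : w (t % n) = w t := by
  have h : ∀ q, w (t % n + n * q) = w (t % n) := by
    intro q
    rw [← iterate_shift (n * q) w, (hw.mul_const q).eq]
  rw [← h (t / n), Nat.mod_add_div]

lemma eq_of_forall_lt (hn : 0 < n) (hu : Function.IsPeriodicPt shift n u)
    (hv : Function.IsPeriodicPt shift n v) (h : ∀ t < n, u t = v t) : u = v := by
  funext t
  rw [← apply_mod hu, ← apply_mod hv, h _ (Nat.mod_lt _ hn)]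

lemma eq_of_key_eq_of_isPeriodicPt (hn : 0 < n) (hu : Function.IsPeriodicPt shift n u)
    (hv : Function.IsPeriodicPt shift n v) (h : key e n u = key e n v) : u = v :=
  eq_of_forall_lt hn hu hv (eq_of_key_eq h)

/-- The number of letters `a` with `e a = true` among the first `r` letters of `w`. -/
def count (e : Bool → Bool) (w : ℕ → Bool) (r : ℕ) : ℕ := ∑ t ∈ Finset.range r, (e (w t)).toNat

lemma count_succ (e : Bool → Bool) (w : ℕ → Bool) (r : ℕ) :
    count e w (r + 1) = count e w r + (e (w r)).toNat := Finset.sum_range_succ _ _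

lemma count_mul (hw : Function.IsPeriodicPt shift n w) (e : Bool → Bool) (q : ℕ) :
    count e w (n * q) = count e w n * q := by
  induction q with
  | zero => simp [count]
  | succ q ih =>
    rw [Nat.mul_succ, count, Finset.sum_range_add, ← count, ih, Nat.mul_succ, add_right_inj, count]
    refine Finset.sum_congr rfl fun t ht => ?_
    rw [← apply_mod hw (n * q + t), Nat.mul_add_mod, Nat.mod_eq_of_lt (Finset.mem_range.1 ht)]

end Sequences

section Splits

variable {e : Bool → Bool} {n : ℕ}

/-! ### Permutations monotone on two blocks, and their itineraries -/

/-- `IsSplit e τ g` says that `g` cuts `Fin n` into an initial block, labelled `false`, and a final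
block, labelled `true` (either may be empty), and that `τ` is decreasing on the block labelled `a`
if `e a = true` and increasing on it otherwise. -/
structure IsSplit (e : Bool → Bool) (τ : Perm (Fin n)) (g : Fin n → Bool) : Prop where
  mono : Monotone g
  oriented : ∀ i j, i < j → g i = g j → Oriented (e (g i)) (τ i) (τ j)

/-- The itinerary of `x`: the labels of `x`, `τ x`, `τ (τ x)`, … -/
def itinerary (τ : Perm (Fin n)) (g : Fin n → Bool) (x : Fin n) : ℕ → Bool :=
  fun t => g ((τ ^ t) x)

section

variable {τ τ' : Perm (Fin n)} {g g' : Fin n → Bool} {x x' a b : Fin n}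

lemma iterate_shift_itinerary (r : ℕ) :
    shift^[r] (itinerary τ g x) = itinerary τ g ((τ ^ r) x) := by
  funext t
  rw [iterate_shift, itinerary, itinerary, pow_add, Perm.mul_apply]

lemma shift_itinerary : shift (itinerary τ g x) = itinerary τ g (τ x) :=
  iterate_shift_itinerary 1

lemma pow_apply_eq_iff (hτ : τ.IsCycleOn Set.univ) (x : Fin n) (s t : ℕ) :
    (τ ^ s) x = (τ ^ t) x ↔ s ≡ t [MOD n] := by
  rw [← Finset.coe_univ] at hτ
  simpa using hτ.pow_apply_eq_pow_apply (Finset.mem_univ x) (m := s) (n := t)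

lemma exists_pow_apply_eq (hτ : τ.IsCycleOn Set.univ) (x y : Fin n) :
    ∃ t : ℕ, (τ ^ t) x = y :=
  hτ.exists_pow_eq' Set.finite_univ (Set.mem_univ _) (Set.mem_univ _)

lemma isPeriodicPt_itinerary (hτ : τ.IsCycleOn Set.univ) :
    IsPeriodicPt shift n (itinerary τ g x) := by
  have h : (τ ^ n) x = (τ ^ 0) x := (pow_apply_eq_iff hτ x n 0).2 (by simp [Nat.ModEq])
  rw [IsPeriodicPt, IsFixedPt, iterate_shift_itinerary, h, pow_zero, Perm.one_apply]

lemma Oriented.asymm {c : Bool} {i j : Fin n} (h : Oriented c i j) : ¬ Oriented c j i := by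
  cases c
  · exact (oriented_false.1 h).asymm ∘ oriented_false.1
  · exact (oriented_true.1 h).asymm ∘ oriented_true.1

/-- Points are ordered like their itineraries. -/
lemma IsSplit.lt_of_key_lt (h : IsSplit e τ g) {N : ℕ}
    (hab : key e N (itinerary τ g a) < key e N (itinerary τ g b)) : a < b := by
  induction N generalizing a b with
  | zero => simp [key] at hab
  | succ N ih =>
    by_cases h0 : g a = g b
    · have h1 := (key_succ_lt_iff (u := itinerary τ g a) (v := itinerary τ g b) h0).1 hab
      rw [shift_itinerary, shift_itinerary] at h1
      have h2 : Oriented (e (g a)) (τ a) (τ b) := by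
        change Oriented (e (g a)) _ _ at h1
        cases hc : e (g a) <;> rw [hc] at h1
        · exact oriented_false.2 (ih (oriented_false.1 h1))
        · exact oriented_true.2 (ih (oriented_true.1 h1))
      rcases lt_trichotomy a b with h3 | rfl | h3
      · exact h3
      · exact absurd h2 h2.asymm
      · have h4 := h.oriented b a h3 h0.symm
        rw [← h0] at h4
        exact absurd h2 h4.asymm
    · by_contra hba
      have h1 := h.mono (not_lt.1 hba)
      have hb : g b = false := by
        cases hb : g b
        · rfl
        · rw [hb] at h1
          exact absurd ((le_antisymm (Bool.le_true _) h1).trans hb.symm) h0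
      have ha : g a = true := by
        cases ha : g a
        · exact absurd (ha.trans hb.symm) h0
        · rfl
      exact hab.asymm (key_succ_lt_of_lt (u := itinerary τ g b) (v := itinerary τ g a) hb ha)

/-- A common prefix of itineraries is traversed with one reversal for each decreasing letter. -/
lemma IsSplit.oriented_pow (h : IsSplit e τ g) (heq : itinerary τ g a = itinerary τ g b)
    (hab : a < b) (t : ℕ) :
    Oriented (decide (Odd (count e (itinerary τ g a) t))) ((τ ^ t) a) ((τ ^ t) b) := by
  induction t with
  | zero => simpa [count] using hab
  | succ t ih =>
    have h0 : g ((τ ^ t) a) = g ((τ ^ t) b) := congrFun heq t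
    rw [count_succ, pow_succ', Perm.mul_apply, Perm.mul_apply]
    change Oriented (decide (Odd (_ + (e (g ((τ ^ t) a))).toNat))) _ _
    by_cases hodd : Odd (count e (itinerary τ g a) t)
    · simp only [hodd, decide_true, oriented_true] at ih
      have h1 := h.oriented _ _ ih h0.symm
      rw [← h0] at h1
      cases hc : e (g ((τ ^ t) a)) <;> rw [hc] at h1
      · simpa [hodd] using h1
      · simpa [hodd, Nat.odd_add_one] using h1
    · simp only [hodd, decide_false, oriented_false] at ih
      have h1 := h.oriented _ _ ih h0
      cases hc : e (g ((τ ^ t) a)) <;> rw [hc] at h1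
      · simpa [hodd] using h1
      · simpa [hodd, Nat.odd_add_one] using h1

/-- If the itinerary of `x` has period `r`, then `τ ^ r` acts on the points with this itinerary, and
it does so increasingly if there is an even number of decreasing letters in a period. An increasing
map with periodic points fixes them, so `τ ^ r` fixes `x`. -/
lemma IsSplit.dvd_of_even (h : IsSplit e τ g) (hτ : τ.IsCycleOn Set.univ) {r : ℕ}
    (hr : IsPeriodicPt shift r (itinerary τ g x)) (he : Even (count e (itinerary τ g x) r)) :
    n ∣ r := by
  have hit : ∀ j, itinerary τ g ((τ ^ (r * j)) x) = itinerary τ g x := fun j => by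
    rw [← iterate_shift_itinerary, (hr.mul_const j).eq]
  have hstep : ∀ i j, (τ ^ (r * i)) x < (τ ^ (r * j)) x →
      (τ ^ (r * (i + 1))) x < (τ ^ (r * (j + 1))) x := fun i j hij => by
    have h1 := h.oriented_pow ((hit i).trans (hit j).symm) hij r
    rw [hit i] at h1
    simp only [Nat.not_odd_iff_even.2 he, decide_false, oriented_false, ← Perm.mul_apply,
      ← pow_add] at h1
    rwa [Nat.mul_succ, Nat.mul_succ, add_comm _ r, add_comm _ r]
  have hfix : (τ ^ (r * n)) x = (τ ^ (r * 0)) x :=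
    (pow_apply_eq_iff hτ x _ _).2 (by simp [Nat.ModEq])
  have hn : 0 < n := x.pos
  suffices hx : (τ ^ (r * 0)) x = (τ ^ (r * 1)) x by
    rw [pow_apply_eq_iff hτ] at hx
    simpa using (Nat.modEq_zero_iff_dvd.1 hx.symm)
  rcases lt_trichotomy ((τ ^ (r * 0)) x) ((τ ^ (r * 1)) x) with hlt | heq | hlt
  · have hm : StrictMono fun j => (τ ^ (r * j)) x := strictMono_nat_of_lt_succ fun j => by
      induction j with
      | zero => exact hlt
      | succ j ih => exact hstep _ _ ih
    exact absurd hfix (hm hn).ne'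
  · exact heq
  · have hm : StrictAnti fun j => (τ ^ (r * j)) x := strictAnti_nat_of_succ_lt fun j => by
      induction j with
      | zero => exact hlt
      | succ j ih => exact hstep _ _ ih
    exact absurd hfix (hm hn).ne

/-- A cyclic permutation with marked point and labels is determined by the itinerary of the marked
point and the order of its orbit. -/
lemma eq_of_orbit_lt_iff (hτ : τ.IsCycleOn Set.univ) (hτ' : τ'.IsCycleOn Set.univ)
    (hw : itinerary τ g x = itinerary τ' g' x')
    (hlt : ∀ s t : ℕ, (τ ^ s) x < (τ ^ t) x → (τ' ^ s) x' < (τ' ^ t) x') :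
    τ = τ' ∧ g = g' ∧ x = x' := by
  choose c hc using exists_pow_apply_eq hτ x
  have hmono : StrictMono fun i => (τ' ^ c i) x' := fun i j hij => by
    apply hlt
    rwa [hc, hc]
  have hid : ∀ i, (τ' ^ c i) x' = i := fun i => by
    have h1 : (fun i => (τ' ^ c i) x') = id :=
      hmono.range_inj strictMono_id |>.1
        (by rw [Set.range_id, (Finite.injective_iff_surjective.1 hmono.injective).range_eq])
    exact congrFun h1 i
  have horb : ∀ s : ℕ, (τ' ^ s) x' = (τ ^ s) x := fun s => by
    rw [← hid ((τ ^ s) x), pow_apply_eq_iff hτ', ← pow_apply_eq_iff hτ x, hc]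
  have hx : x' = x := horb 0
  refine ⟨Equiv.ext fun i => ?_, funext fun i => ?_, hx.symm⟩
  · rw [← hc i, ← Perm.mul_apply, ← pow_succ', ← horb, pow_succ', Perm.mul_apply, horb]
  · have h1 := congrFun hw (c i)
    rw [itinerary, itinerary, horb, hc] at h1
    exact h1

end

/-- The cyclic permutations that are monotone on two blocks as prescribed by `e`, together with the
labelling of the blocks and a marked point. -/
def triples (e : Bool → Bool) (n : ℕ) : Set (Perm (Fin n) × (Fin n → Bool) × Fin n) :=
  {T | T.1.IsCycleOn Set.univ ∧ IsSplit e T.1 T.2.1}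

/-- The itinerary of the marked point. -/
def word (T : Perm (Fin n) × (Fin n → Bool) × Fin n) : ℕ → Bool := itinerary T.1 T.2.1 T.2.2

/-- Any ordering of `ℤ/n` whose compatibility with the labels `W` and with the translation by `1`
is that of an orbit comes from a permutation. -/
lemma exists_triple [NeZero n] {α : Type*} [LinearOrder α] (κ : ZMod n → α)
    (hκ : Injective κ) (W : ZMod n → Bool) (hmono : ∀ s t, κ s ≤ κ t → W s ≤ W t)
    (hor : ∀ s t, κ s < κ t → W s = W t → Oriented (e (W s)) (κ (s + 1)) (κ (t + 1))) :
    ∃ T ∈ triples e n, (∀ t : ℕ, word T t = W t) ∧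
      ∀ s t : ℕ, (T.1 ^ s) T.2.2 < (T.1 ^ t) T.2.2 ↔ κ s < κ t := by
  classical
  have hcard : (Finset.univ.image κ).card = n := by
    rw [Finset.card_image_of_injective _ hκ, Finset.card_univ, ZMod.card]
  let ψ := (Finset.univ.image κ).orderIsoOfFin hcard
  let φ₀ : ZMod n → Fin n := fun s => ψ.symm ⟨κ s, Finset.mem_image_of_mem κ (Finset.mem_univ s)⟩
  have hlt : ∀ s t, φ₀ s < φ₀ t ↔ κ s < κ t := fun s t => by
    simp only [φ₀, OrderIso.lt_iff_lt, Subtype.mk_lt_mk]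
  have hinj : Injective φ₀ := fun s t hst => by
    simpa [φ₀, hκ.eq_iff] using hst
  let φ : ZMod n ≃ Fin n := Equiv.ofBijective φ₀
    ((Fintype.bijective_iff_injective_and_card _).2 ⟨hinj, by simp⟩)
  have hle : ∀ s t, φ s ≤ φ t ↔ κ s ≤ κ t := fun s t => by
    rw [← not_lt, ← not_lt]
    exact not_congr (hlt t s)
  let τ : Perm (Fin n) := (φ.symm.trans (Equiv.addRight 1)).trans φ
  have hτ : ∀ s, τ (φ s) = φ (s + 1) := fun s => by simp [τ]
  have hpow : ∀ (t : ℕ) s, (τ ^ t) (φ s) = φ (s + t) := fun t => by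
    induction t with
    | zero => simp
    | succ t ih =>
      intro s
      rw [pow_succ', Perm.mul_apply, ih, hτ, Nat.cast_succ, add_assoc]
  refine ⟨(τ, W ∘ φ.symm, φ 0), ⟨⟨Set.bijOn_univ.2 τ.bijective, fun i _ j _ => ?_⟩, ?_, ?_⟩, ?_, ?_⟩
  · obtain ⟨s, rfl⟩ := φ.surjective i
    refine ⟨((φ.symm j - s).val : ℕ), ?_⟩
    rw [zpow_natCast, hpow]
    simp
  · intro i j hij
    obtain ⟨s, rfl⟩ := φ.surjective i
    obtain ⟨t, rfl⟩ := φ.surjective j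
    simpa using hmono s t ((hle s t).1 hij)
  · intro i j hij h0
    obtain ⟨s, rfl⟩ := φ.surjective i
    obtain ⟨t, rfl⟩ := φ.surjective j
    simp only [comp_apply, symm_apply_apply] at h0 ⊢
    rw [hτ, hτ]
    have h1 := hor s t ((hlt s t).1 hij) h0
    cases hc : e (W s) <;> rw [hc] at h1
    · exact oriented_false.2 ((hlt _ _).2 (oriented_false.1 h1))
    · exact oriented_true.2 ((hlt _ _).2 (oriented_true.1 h1))
  · intro t
    simp [word, itinerary, hpow]
  · intro s t
    simp only [hpow, zero_add]
    exact hlt _ _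

end Splits

section Words

variable {e : Bool → Bool} {n m : ℕ} {w : ℕ → Bool}
  {T T' : Perm (Fin n) × (Fin n → Bool) × Fin n}

/-! ### Triples with a given itinerary -/

lemma iterate_shift_eq_iff (hw : minimalPeriod shift w = m) (hm : 0 < m) (s t : ℕ) :
    shift^[s] w = shift^[t] w ↔ s ≡ t [MOD m] := by
  rw [← iterate_mod_minimalPeriod_eq, ← iterate_mod_minimalPeriod_eq (n := t), hw,
    iterate_eq_iterate_iff_of_lt_minimalPeriod]
  · rfl
  all_goals rw [hw]; exact Nat.mod_lt _ hm

lemma isPeriodicPt_iterate {p : ℕ} (hw : IsPeriodicPt shift p w) (s : ℕ) :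
    IsPeriodicPt shift p (shift^[s] w) := by
  rw [IsPeriodicPt, IsFixedPt, ← iterate_add_apply, add_comm, iterate_add_apply, hw.eq]

lemma isPeriodicPt_word (hT : T ∈ triples e n) : IsPeriodicPt shift n (word T) :=
  isPeriodicPt_itinerary hT.1

lemma orbit_lt_iff (hT : T ∈ triples e n) {s t : ℕ}
    (hst : shift^[s] (word T) ≠ shift^[t] (word T)) :
    (T.1 ^ s) T.2.2 < (T.1 ^ t) T.2.2 ↔
      key e n (shift^[s] (word T)) < key e n (shift^[t] (word T)) := by
  have hn : 0 < n := T.2.2.pos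
  have hkey : key e n (shift^[s] (word T)) ≠ key e n (shift^[t] (word T)) := fun h =>
    hst (eq_of_key_eq_of_isPeriodicPt hn (isPeriodicPt_iterate (isPeriodicPt_word hT) s)
      (isPeriodicPt_iterate (isPeriodicPt_word hT) t) h)
  have hlt : ∀ {s t : ℕ}, key e n (shift^[s] (word T)) < key e n (shift^[t] (word T)) →
      (T.1 ^ s) T.2.2 < (T.1 ^ t) T.2.2 := fun h => by
    rw [word, iterate_shift_itinerary, iterate_shift_itinerary] at h
    exact hT.2.lt_of_key_lt h
  refine ⟨fun h => ?_, hlt⟩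
  by_contra h1
  exact h.asymm (hlt (lt_of_le_of_ne (not_lt.1 h1) hkey.symm))

lemma triple_ext (hT : T ∈ triples e n) (hT' : T' ∈ triples e n) (hw : word T = word T')
    (hlt : ∀ s t : ℕ, (T.1 ^ s) T.2.2 < (T.1 ^ t) T.2.2 →
      (T'.1 ^ s) T'.2.2 < (T'.1 ^ t) T'.2.2) : T = T' := by
  obtain ⟨h1, h2, h3⟩ := eq_of_orbit_lt_iff hT.1 hT'.1 hw hlt
  exact Prod.ext h1 (Prod.ext h2 h3)

lemma injOn_word : Set.InjOn word {T ∈ triples e n | minimalPeriod shift (word T) = n} := by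
  rintro T ⟨hT, hp⟩ T' ⟨hT', -⟩ hw
  refine triple_ext hT hT' hw fun s t h => ?_
  have hst : shift^[s] (word T) ≠ shift^[t] (word T) := fun hst =>
    h.ne ((pow_apply_eq_iff hT.1 _ _ _).2 ((iterate_shift_eq_iff hp T.2.2.pos s t).1 hst))
  rw [orbit_lt_iff hT hst] at h
  rw [hw] at h hst
  exact (orbit_lt_iff hT' hst).2 h

lemma val_natCast_iterate_shift [NeZero n] (hw : IsPeriodicPt shift n w) (s : ℕ) :
    shift^[(s : ZMod n).val] w = shift^[s] w := by
  rw [ZMod.val_natCast, hw.iterate_mod_apply]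

/-- An aperiodic word of length `n` is an itinerary: order `ℤ/n` like the rotations of the word. -/
lemma surjOn_word (hn : 0 < n) (e : Bool → Bool) :
    Set.SurjOn word {T ∈ triples e n | minimalPeriod shift (word T) = n}
      {w | minimalPeriod shift w = n} := by
  intro w hp
  rw [Set.mem_ofPred_eq] at hp
  have : NeZero n := ⟨hn.ne'⟩
  have hw : IsPeriodicPt shift n w := by
    have := isPeriodicPt_minimalPeriod shift w
    rwa [hp] at this
  let κ : ZMod n → ℕ := fun s => key e n (shift^[s.val] w)
  have hκ : ∀ s : ℕ, κ s = key e n (shift^[s] w) := fun s => by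
    simp only [κ, val_natCast_iterate_shift hw]
  let W : ZMod n → Bool := fun s => shift^[s.val] w 0
  have hW : ∀ s : ℕ, W s = shift^[s] w 0 := fun s => by
    simp only [W, val_natCast_iterate_shift hw]
  have hinj : Injective κ := by
    intro s t hst
    obtain ⟨s, rfl⟩ := ZMod.natCast_zmod_surjective s
    obtain ⟨t, rfl⟩ := ZMod.natCast_zmod_surjective t
    rw [hκ, hκ] at hst
    rw [ZMod.natCast_eq_natCast_iff, ← iterate_shift_eq_iff hp hn]
    exact eq_of_key_eq_of_isPeriodicPt hn (isPeriodicPt_iterate hw _)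
      (isPeriodicPt_iterate hw _) hst
  have hmono : ∀ s t, κ s ≤ κ t → W s ≤ W t := by
    intro s t hst
    exact apply_zero_le_of_key_le hn hst
  have hor : ∀ s t, κ s < κ t → W s = W t →
      Oriented (e (W s)) (κ (s + 1)) (κ (t + 1)) := by
    intro s t hst h0
    obtain ⟨s, rfl⟩ := ZMod.natCast_zmod_surjective s
    obtain ⟨t, rfl⟩ := ZMod.natCast_zmod_surjective t
    rw [hκ, hκ] at hst
    rw [hW, hW] at h0
    rw [← Nat.cast_succ, ← Nat.cast_succ, hκ, hκ, hW, iterate_succ_apply', iterate_succ_apply']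
    exact oriented_key_shift h0 hst
  obtain ⟨T, hT, hword, -⟩ := exists_triple (e := e) κ hinj W hmono hor
  have hTw : word T = w := funext fun t => by rw [hword, hW, iterate_shift, zero_add]
  exact ⟨T, ⟨hT, hTw ▸ hp⟩, hTw⟩

/-- The number of aperiodic words of length `n` with property `p`, counted as `n`-periodic
sequences. -/
noncomputable def aperiodicCount (p : (ℕ → Bool) → Prop) (n : ℕ) : ℕ :=
  {w | minimalPeriod shift w = n ∧ p w}.ncard

lemma ncard_triples_of_minimalPeriod (hn : 0 < n) (e : Bool → Bool) (p : (ℕ → Bool) → Prop) :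
    {T ∈ triples e n | minimalPeriod shift (word T) = n ∧ p (word T)}.ncard =
      aperiodicCount p n := by
  have hinj : Set.InjOn word {T ∈ triples e n | minimalPeriod shift (word T) = n ∧ p (word T)} :=
    fun T hT T' hT' => injOn_word ⟨hT.1, hT.2.1⟩ ⟨hT'.1, hT'.2.1⟩
  rw [aperiodicCount, ← hinj.ncard_image]
  congr 1
  ext w
  constructor
  · rintro ⟨T, hT, rfl⟩
    exact hT.2
  · rintro ⟨hw, hp⟩
    obtain ⟨T, hT, rfl⟩ := surjOn_word hn e hw
    exact ⟨T, ⟨hT.1, hw, hp⟩, rfl⟩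

/-! ### The period of an itinerary -/

lemma minimalPeriod_dvd (hT : T ∈ triples e n) : minimalPeriod shift (word T) ∣ n :=
  (isPeriodicPt_word hT).minimalPeriod_dvd

lemma minimalPeriod_eq_of_even (hT : T ∈ triples e n)
    (he : Even (count e (word T) (minimalPeriod shift (word T)))) :
    minimalPeriod shift (word T) = n :=
  Nat.dvd_antisymm (minimalPeriod_dvd hT)
    (hT.2.dvd_of_even hT.1 (isPeriodicPt_minimalPeriod _ _) he)

/-- Two periods of a word always contain an even number of decreasing letters. -/
lemma minimalPeriod_eq_or (hT : T ∈ triples e n) :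
    minimalPeriod shift (word T) = n ∨ n = 2 * minimalPeriod shift (word T) := by
  obtain ⟨q, hq⟩ := minimalPeriod_dvd hT
  have hper := isPeriodicPt_minimalPeriod shift (word T)
  have h2 : n ∣ minimalPeriod shift (word T) * 2 := by
    refine hT.2.dvd_of_even hT.1 (hper.mul_const 2) ?_
    change Even (count e (word T) _)
    rw [count_mul hper]
    exact even_two.mul_left _
  have hn : 0 < n := T.2.2.pos
  generalize minimalPeriod shift (word T) = d at *
  have hd : 0 < d := Nat.pos_of_ne_zero fun h => by simp [h] at hq; omega
  rw [hq] at h2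
  have hq2 : q ≤ 2 := Nat.le_of_dvd two_pos (Nat.dvd_of_mul_dvd_mul_left hd h2)
  interval_cases q <;> omega

lemma minimalPeriod_eq_of_odd (hT : T ∈ triples e n) (ho : Odd (count e (word T) n)) :
    minimalPeriod shift (word T) = n := by
  rcases minimalPeriod_eq_or hT with h | h
  · exact h
  · have h2 := count_mul (isPeriodicPt_minimalPeriod shift (word T)) e 2
    rw [mul_comm, ← h] at h2
    rw [h2] at ho
    exact absurd ho (Nat.not_odd_iff_even.2 (even_two.mul_left _))

/-! ### Decreasing blocks and words that are squares -/

lemma count_const_true (w : ℕ → Bool) (r : ℕ) : count (fun _ => true) w r = r := by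
  simp [count]

/-- If both blocks are decreasing and the itinerary is the square of a word of odd length, the order
of the orbit is determined by that of its points number `0` and `m`. -/
lemma injOn_word_lt (hm : Odd m) :
    Set.InjOn (fun T => (word T, decide (T.2.2 < (T.1 ^ m) T.2.2)))
      {T ∈ triples (fun _ => true) (2 * m) | minimalPeriod shift (word T) = m} := by
  rintro T ⟨hT, hp⟩ T' ⟨hT', -⟩ h
  simp only [Prod.mk.injEq, decide_eq_decide] at h
  obtain ⟨hw, hx⟩ := h
  refine triple_ext hT hT' hw fun s t h => ?_
  by_cases hst : shift^[s] (word T) = shift^[t] (word T)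
  · rw [iterate_shift_eq_iff hp hm.pos] at hst
    have hmod : ¬ s ≡ t [MOD 2 * m] := fun h1 => h.ne ((pow_apply_eq_iff hT.1 _ _ _).2 h1)
    -- The only other position with the same rotation as `s` is `s + m`.
    have hts : t ≡ s + m [MOD 2 * m] := by
      rw [← Nat.modEq_and_modEq_iff_modEq_mul (Nat.coprime_two_left.2 hm)] at hmod ⊢
      refine ⟨?_, hst.symm.trans (by simp [Nat.ModEq])⟩
      have h1 : ¬ s ≡ t [MOD 2] := fun h2 => hmod ⟨h2, hst⟩
      have h2 := Nat.odd_iff.1 hm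
      simp only [Nat.ModEq] at h1 ⊢
      omega
    -- The shift reverses the order of two points with the same itinerary.
    have horder : ∀ U ∈ triples (fun _ => true) (2 * m), word U = word T →
        ((U.1 ^ s) U.2.2 < (U.1 ^ (s + m)) U.2.2 ↔
          (U.2.2 < (U.1 ^ m) U.2.2 ↔ Even s)) := by
      intro U hU hUw
      have hit : itinerary U.1 U.2.1 U.2.2 = itinerary U.1 U.2.1 ((U.1 ^ m) U.2.2) := by
        rw [← iterate_shift_itinerary]
        change word U = shift^[m] (word U)
        rw [hUw]
        exact (hp ▸ isPeriodicPt_minimalPeriod shift (word T)).eq.symm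
      have hne : U.2.2 ≠ (U.1 ^ m) U.2.2 := fun h1 => by
        have h2 := (pow_apply_eq_iff hU.1 U.2.2 0 m).1 h1
        have h3 := Nat.le_of_dvd hm.pos (Nat.modEq_zero_iff_dvd.1 h2.symm)
        have := hm.pos
        omega
      rw [pow_add, Perm.mul_apply]
      rcases hne.lt_or_gt with h1 | h1
      · have h2 := hU.2.oriented_pow hit h1 s
        rw [count_const_true] at h2
        rcases Nat.even_or_odd s with h3 | h3
        · simpa [h1, h3, Nat.not_odd_iff_even.2 h3] using h2
        · simpa [h1, h3, Nat.not_even_iff_odd.2 h3] using (show _ < _ by simpa [h3] using h2).le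
      · have h2 := hU.2.oriented_pow hit.symm h1 s
        rw [count_const_true] at h2
        rcases Nat.even_or_odd s with h3 | h3
        · simpa [h1.not_gt, h3] using
            (show _ < _ by simpa [Nat.not_odd_iff_even.2 h3] using h2).le
        · simpa [h1.not_gt, h3, Nat.not_even_iff_odd.2 h3] using h2
    rw [(pow_apply_eq_iff hT.1 _ _ _).2 hts] at h
    rw [(pow_apply_eq_iff hT'.1 _ _ _).2 hts, horder T' hT' hw.symm, ← hx]
    exact (horder T hT rfl).1 h
  · rw [orbit_lt_iff hT hst] at h
    rw [hw] at h hst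
    exact (orbit_lt_iff hT' hst).2 h

/-- Conversely, both orders occur: the two occurrences of each rotation are told apart by the parity
of their positions, which the shift exchanges. -/
lemma surjOn_word_lt (hm : Odd m) :
    Set.SurjOn (fun T => (word T, decide (T.2.2 < (T.1 ^ m) T.2.2)))
      {T ∈ triples (fun _ => true) (2 * m) | minimalPeriod shift (word T) = m}
      ({w | minimalPeriod shift w = m} ×ˢ Set.univ) := by
  rintro ⟨w, c⟩ ⟨hp, -⟩
  simp only [Set.mem_ofPred_eq] at hp
  have hn : 0 < 2 * m := by have := hm.pos; omega
  have : NeZero (2 * m) := ⟨hn.ne'⟩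
  have hwm : IsPeriodicPt shift m w := hp ▸ isPeriodicPt_minimalPeriod shift w
  have hw : IsPeriodicPt shift (2 * m) w := hwm.const_mul 2
  -- Positions `0` and `m` carry the same rotation and opposite parities; the offset `b` decides which
  -- of them comes first.
  set b := (!c).toNat with hb
  let e : Bool → Bool := fun _ => true
  let κ : ZMod (2 * m) → ℕ := fun s => 2 * key e (2 * m) (shift^[s.val] w) + (s.val + b) % 2
  have hκ : ∀ s : ℕ, κ s = 2 * key e (2 * m) (shift^[s] w) + (s + b) % 2 := fun s => by
    simp only [κ, val_natCast_iterate_shift hw]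
    rw [ZMod.val_natCast]
    have := Nat.mod_mul_right_mod s 2 m
    omega
  let W : ZMod (2 * m) → Bool := fun s => shift^[s.val] w 0
  have hW : ∀ s : ℕ, W s = shift^[s] w 0 := fun s => by
    simp only [W, val_natCast_iterate_shift hw]
  have hinj : Injective κ := by
    intro s t hst
    obtain ⟨s, rfl⟩ := ZMod.natCast_zmod_surjective s
    obtain ⟨t, rfl⟩ := ZMod.natCast_zmod_surjective t
    rw [hκ, hκ] at hst
    rw [ZMod.natCast_eq_natCast_iff, ← Nat.modEq_and_modEq_iff_modEq_mul
      (Nat.coprime_two_left.2 hm), ← iterate_shift_eq_iff hp hm.pos]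
    refine ⟨by simp only [Nat.ModEq]; omega, ?_⟩
    exact eq_of_key_eq_of_isPeriodicPt hn (isPeriodicPt_iterate hw _)
      (isPeriodicPt_iterate hw _) (e := e) (by omega)
  have hmono : ∀ s t, κ s ≤ κ t → W s ≤ W t := by
    intro s t hst
    exact apply_zero_le_of_key_le hn (e := e) (by simp only [κ] at hst; omega)
  have hor : ∀ s t, κ s < κ t → W s = W t →
      Oriented (e (W s)) (κ (s + 1)) (κ (t + 1)) := by
    intro s t hst h0
    obtain ⟨s, rfl⟩ := ZMod.natCast_zmod_surjective s
    obtain ⟨t, rfl⟩ := ZMod.natCast_zmod_surjective t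
    rw [hκ, hκ] at hst
    rw [hW, hW] at h0
    rw [← Nat.cast_succ, ← Nat.cast_succ, hκ, hκ, iterate_succ_apply', iterate_succ_apply']
    refine oriented_true.2 ?_
    rcases lt_trichotomy (key e (2 * m) (shift^[s] w)) (key e (2 * m) (shift^[t] w))
      with h1 | h1 | h1
    · have h2 := oriented_true.1 (oriented_key_shift h0 h1)
      omega
    · rw [eq_of_key_eq_of_isPeriodicPt hn (isPeriodicPt_iterate hw s)
        (isPeriodicPt_iterate hw t) h1]
      omega
    · omega
  obtain ⟨T, hT, hword, hlt⟩ := exists_triple (e := e) κ hinj W hmono hor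
  have hTw : word T = w := funext fun t => by rw [hword, hW, iterate_shift, zero_add]
  refine ⟨T, ⟨hT, hTw ▸ hp⟩, Prod.ext hTw ?_⟩
  have h1 := hlt 0 m
  rw [hκ, hκ, hwm.eq, pow_zero, Perm.one_apply] at h1
  simp only [h1, iterate_zero, id]
  have := Nat.odd_iff.1 hm
  cases c <;> simp [hb] <;> omega

lemma ncard_triples_of_square (hm : Odd m) :
    {T ∈ triples (fun _ => true) (2 * m) | minimalPeriod shift (word T) = m}.ncard =
      2 * aperiodicCount (fun _ => True) m := by
  rw [← (injOn_word_lt hm).ncard_image, aperiodicCount]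
  have himage : (fun T => (word T, decide (T.2.2 < (T.1 ^ m) T.2.2))) ''
      {T ∈ triples (fun _ => true) (2 * m) | minimalPeriod shift (word T) = m} =
      {w | minimalPeriod shift w = m ∧ True} ×ˢ Set.univ := by
    refine Set.Subset.antisymm ?_ (by simp only [and_true]; exact surjOn_word_lt hm)
    rintro _ ⟨T, hT, rfl⟩
    exact ⟨⟨hT.2, trivial⟩, trivial⟩
  rw [himage, Set.ncard_prod, Set.ncard_univ, Nat.card_eq_fintype_card, Fintype.card_bool,
    mul_comm]

end Words

section Counting

/-! ### Counting aperiodic binary words -/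

variable {n : ℕ}

/-- A sequence of period `n` is the same as a word of length `n`. -/
def periodicEquiv (hn : 0 < n) : {w : ℕ → Bool // IsPeriodicPt shift n w} ≃ (Fin n → Bool) where
  toFun w i := w.1 i
  invFun f := ⟨fun t => f ⟨t % n, Nat.mod_lt t hn⟩, funext fun t => by simp [iterate_shift]⟩
  left_inv w := Subtype.ext (funext fun t => apply_mod w.2 t)
  right_inv f := funext fun i => by simp [Nat.mod_eq_of_lt i.2]

lemma ncard_periodic (hn : 0 < n) : {w | IsPeriodicPt shift n w}.ncard = 2 ^ n := by
  rw [← Nat.card_coe_set_eq]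
  exact (Nat.card_congr (periodicEquiv hn)).trans (by simp)

lemma finite_periodic (hn : 0 < n) : {w | IsPeriodicPt shift n w}.Finite :=
  Set.finite_coe_iff.1 (Finite.of_equiv _ (periodicEquiv hn).symm)

lemma count_id_periodicEquiv (hn : 0 < n) (w : {w : ℕ → Bool // IsPeriodicPt shift n w}) :
    count id w.1 n = ∑ i, (periodicEquiv hn w i).toNat :=
  Finset.sum_range _

/-- The first letter of a word is determined by the parity of its number of `true` letters and by
its other letters, which are arbitrary. -/
lemma card_odd_words (k : ℕ) :
    Nat.card {f : Fin (k + 1) → Bool // Odd (∑ i, (f i).toNat)} = 2 ^ k := by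
  have hbij : Bijective fun f : {f : Fin (k + 1) → Bool // Odd (∑ i, (f i).toNat)} =>
      (fun i : Fin k => f.1 i.succ) := by
    constructor
    · rintro ⟨f, hf⟩ ⟨f', hf'⟩ h
      simp only at h
      rw [Fin.sum_univ_succ] at hf hf'
      have hsucc : ∀ i : Fin k, f i.succ = f' i.succ := congrFun h
      simp only [hsucc] at hf
      have h0 : f 0 = f' 0 := by
        cases h1 : f 0 <;> cases h2 : f' 0 <;> simp_all [← Nat.not_even_iff_odd]
      exact Subtype.ext (funext fun i => Fin.cases h0 hsucc i)
    · intro g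
      refine ⟨⟨Fin.cons (decide (Even (∑ i, (g i).toNat))) g, ?_⟩, ?_⟩
      · rw [Fin.sum_univ_succ]
        simp only [Fin.cons_zero, Fin.cons_succ]
        by_cases h : Even (∑ i, (g i).toNat)
        · simp only [h, decide_true, Bool.toNat_true]
          exact h.one_add
        · simpa [h] using Nat.not_even_iff_odd.1 h
      · funext i
        simp
  rw [Nat.card_congr (Equiv.ofBijective _ hbij)]
  simp

lemma ncard_periodic_odd (hn : 0 < n) :
    2 * {w | IsPeriodicPt shift n w ∧ Odd (count id w n)}.ncard = 2 ^ n := by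
  have e1 : {w | IsPeriodicPt shift n w ∧ Odd (count id w n)} ≃
      {f : Fin n → Bool // Odd (∑ i, (f i).toNat)} :=
    (Equiv.subtypeSubtypeEquivSubtypeInter (IsPeriodicPt shift n)
      (fun w => Odd (count id w n))).symm.trans
      ((periodicEquiv hn).subtypeEquiv fun w => by rw [count_id_periodicEquiv hn])
  rw [← Nat.card_coe_set_eq, Nat.card_congr e1]
  obtain ⟨k, rfl⟩ : ∃ k, n = k + 1 := ⟨n - 1, by omega⟩
  rw [card_odd_words, pow_succ, mul_comm]

lemma ncard_eq_sum_minimalPeriod (hn : 0 < n) {X : Set (ℕ → Bool)}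
    (hX : X ⊆ {w | IsPeriodicPt shift n w}) :
    X.ncard = ∑ d ∈ n.divisors, {w | minimalPeriod shift w = d ∧ w ∈ X}.ncard := by
  classical
  have hfin := (finite_periodic hn).subset hX
  rw [Set.ncard_eq_toFinset_card X hfin,
    Finset.card_eq_sum_card_fiberwise (f := minimalPeriod shift) (t := n.divisors)]
  · refine Finset.sum_congr rfl fun d _ => ?_
    rw [← Set.ncard_coe_finset]
    congr 1
    ext w
    simp [and_comm]
  · intro w hw
    have h1 : IsPeriodicPt shift n w := hX (hfin.mem_toFinset.1 hw)
    simpa [hn.ne'] using h1.minimalPeriod_dvd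

lemma isPeriodicPt_of_minimalPeriod {d : ℕ} {w : ℕ → Bool} (hw : minimalPeriod shift w = d)
    (hd : d ∣ n) : IsPeriodicPt shift n w :=
  (isPeriodicPt_minimalPeriod shift w).trans_dvd (hw ▸ hd)

lemma sum_aperiodicCount (hn : 0 < n) :
    ∑ d ∈ n.divisors, aperiodicCount (fun _ => True) d = 2 ^ n := by
  rw [← ncard_periodic hn, ncard_eq_sum_minimalPeriod hn subset_rfl]
  refine Finset.sum_congr rfl fun d hd => ?_
  rw [aperiodicCount]
  congr 1
  ext w
  exact and_congr_right fun hw => iff_of_true trivial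
    (isPeriodicPt_of_minimalPeriod hw (Nat.dvd_of_mem_divisors hd))

/-- The number of aperiodic words of length `n` with an odd number of letters `true`. -/
noncomputable def oddAperiodicCount (n : ℕ) : ℕ := aperiodicCount (fun w => Odd (count id w n)) n

/-- A word with an odd number of letters `true` is an odd power of an aperiodic word with the same
property. -/
lemma sum_oddAperiodicCount (hn : 0 < n) :
    ∑ d ∈ n.divisors with Odd d, 2 * oddAperiodicCount (n / d) = 2 ^ n := by
  rw [← ncard_periodic_odd hn, ← Finset.mul_sum,
    ncard_eq_sum_minimalPeriod hn (fun w hw => hw.1), ← Nat.sum_div_divisors, Finset.sum_filter]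
  congr 1
  refine Finset.sum_congr rfl fun d hd => ?_
  obtain ⟨q, rfl⟩ := Nat.dvd_of_mem_divisors hd
  have hd0 : 0 < d := Nat.pos_of_mul_pos_right hn
  rw [Nat.mul_div_cancel_left q hd0, oddAperiodicCount, aperiodicCount]
  have hcount : ∀ w, minimalPeriod shift w = q →
      count id w (d * q) = count id w q * d := fun w hw => by
    rw [mul_comm, count_mul (hw ▸ isPeriodicPt_minimalPeriod shift w)]
  split_ifs with hodd
  · congr 1
    ext w
    refine and_congr_right fun hw => ?_
    have h1 := hcount w hw
    rw [Set.mem_ofPred_eq, h1, Nat.odd_mul]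
    exact ⟨fun h => ⟨isPeriodicPt_of_minimalPeriod hw (dvd_mul_left q d), h, hodd⟩,
      fun h => h.2.1⟩
  · symm
    rw [Set.ncard_eq_zero ((finite_periodic hn).subset fun w hw => hw.2.1),
      Set.eq_empty_iff_forall_notMem]
    rintro w ⟨hw, -, h2⟩
    rw [hcount w hw, Nat.odd_mul] at h2
    exact hodd h2.2

lemma aperiodicCount_eq (hn : 0 < n) :
    (aperiodicCount (fun _ => True) n : ℚ) =
      ∑ d ∈ n.divisors, (ArithmeticFunction.moebius d : ℚ) * 2 ^ (n / d) := by
  have h := (ArithmeticFunction.sum_eq_iff_sum_mul_moebius_eq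
    (f := fun d => (aperiodicCount (fun _ => True) d : ℚ)) (g := fun d => 2 ^ d)).1
    (fun k hk => by exact_mod_cast sum_aperiodicCount hk) n hn
  rw [← h, Nat.sum_divisorsAntidiagonal
    (fun i j => (ArithmeticFunction.moebius i : ℚ) * 2 ^ j)]

lemma filter_odd_divisors {a m : ℕ} (hm : Odd m) :
    {d ∈ (2 ^ a * m).divisors | Odd d} = m.divisors := by
  ext d
  have hm0 : m ≠ 0 := hm.pos.ne'
  simp only [Finset.mem_filter, Nat.mem_divisors]
  constructor
  · rintro ⟨⟨h1, -⟩, h2⟩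
    exact ⟨(Nat.Coprime.pow_right a (Nat.coprime_two_right.2 h2)).dvd_of_dvd_mul_left h1, hm0⟩
  · rintro ⟨h1, -⟩
    exact ⟨⟨h1.mul_left _, by positivity⟩, hm.of_dvd_nat h1⟩

/-- Möbius inversion over the odd divisors of `n`, which are the divisors of its odd part. -/
lemma two_mul_oddAperiodicCount_eq (hn : 0 < n) :
    2 * (oddAperiodicCount n : ℚ) =
      ∑ d ∈ n.divisors with Odd d, (ArithmeticFunction.moebius d : ℚ) * 2 ^ (n / d) := by
  obtain ⟨a, m, hm, rfl⟩ := Nat.exists_eq_two_pow_mul_odd hn.ne'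
  have h := (ArithmeticFunction.sum_eq_iff_sum_mul_moebius_eq_on
    (f := fun d => 2 * (oddAperiodicCount (2 ^ a * d) : ℚ)) (g := fun d => 2 ^ (2 ^ a * d))
    {d | Odd d} (fun c d hcd hd => Odd.of_dvd_nat hd hcd)).1 ?_ m hm.pos hm
  · rw [← h, filter_odd_divisors hm, Nat.sum_divisorsAntidiagonal
      (fun i j => (ArithmeticFunction.moebius i : ℚ) * 2 ^ (2 ^ a * j))]
    refine Finset.sum_congr rfl fun d hd => ?_
    rw [Nat.mul_div_assoc _ (Nat.dvd_of_mem_divisors hd)]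
  · intro k hk hodd
    have h1 := sum_oddAperiodicCount (n := 2 ^ a * k) (by positivity)
    rw [filter_odd_divisors hodd] at h1
    rw [← Nat.sum_div_divisors]
    have h2 : ∀ d ∈ k.divisors, 2 * (oddAperiodicCount (2 ^ a * (k / d)) : ℚ) =
        (2 * oddAperiodicCount (2 ^ a * k / d) : ℕ) := fun d hd => by
      rw [Nat.mul_div_assoc _ (Nat.dvd_of_mem_divisors hd)]
      push_cast
      rfl
    rw [Finset.sum_congr rfl h2]
    exact_mod_cast h1

end Counting

section Patterns

/-! ### Patterns of length three and four -/

variable {n : ℕ} {τ : Perm (Fin n)}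

lemma lt_iff_lt_swap {i j : Fin n} {a b : ℕ} (hij : i ≠ j) (hab : a ≠ b)
    (h : τ i < τ j ↔ a < b) : τ j < τ i ↔ b < a := by
  rcases lt_or_gt_of_ne (τ.injective.ne hij) with h1 | h1
  · exact iff_of_false h1.asymm (h.1 h1).asymm
  · exact iff_of_true h1 (lt_of_le_of_ne (not_lt.1 fun h2 => h1.asymm (h.2 h2)) hab.symm)

lemma contains_three {a b c : ℕ} (hab : a ≠ b) (hac : a ≠ c) (hbc : b ≠ c) :
    Contains τ [a, b, c] ↔ ∃ i j k, i < j ∧ j < k ∧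
      (τ i < τ j ↔ a < b) ∧ (τ i < τ k ↔ a < c) ∧ (τ j < τ k ↔ b < c) := by
  constructor
  · rintro ⟨f, hf, h⟩
    change Fin 3 → Fin n at f
    exact ⟨f 0, f 1, f 2, hf (show (0 : Fin 3) < 1 by decide), hf (show (1 : Fin 3) < 2 by decide),
      h (0 : Fin 3) (1 : Fin 3), h (0 : Fin 3) (2 : Fin 3), h (1 : Fin 3) (2 : Fin 3)⟩
  · rintro ⟨i, j, k, hij, hjk, h1, h2, h3⟩
    have hik := hij.trans hjk
    refine ⟨(![i, j, k] : Fin 3 → Fin n), ?_, ?_⟩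
    · change StrictMono (![i, j, k] : Fin 3 → Fin n)
      rw [Fin.strictMono_iff_lt_succ]
      intro s
      fin_cases s
      exacts [hij, hjk]
    · intro s t
      change Fin 3 at s t
      fin_cases s <;> fin_cases t
      exacts [iff_of_false (lt_irrefl _) (lt_irrefl _), h1, h2,
        lt_iff_lt_swap hij.ne hab h1, iff_of_false (lt_irrefl _) (lt_irrefl _), h3,
        lt_iff_lt_swap hik.ne hac h2, lt_iff_lt_swap hjk.ne hbc h3,
        iff_of_false (lt_irrefl _) (lt_irrefl _)]

lemma contains_four {a b c d : ℕ} (hab : a ≠ b) (hac : a ≠ c) (had : a ≠ d) (hbc : b ≠ c)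
    (hbd : b ≠ d) (hcd : c ≠ d) :
    Contains τ [a, b, c, d] ↔ ∃ i j k l, i < j ∧ j < k ∧ k < l ∧
      (τ i < τ j ↔ a < b) ∧ (τ i < τ k ↔ a < c) ∧ (τ i < τ l ↔ a < d) ∧
      (τ j < τ k ↔ b < c) ∧ (τ j < τ l ↔ b < d) ∧ (τ k < τ l ↔ c < d) := by
  constructor
  · rintro ⟨f, hf, h⟩
    change Fin 4 → Fin n at f
    exact ⟨f 0, f 1, f 2, f 3, hf (show (0 : Fin 4) < 1 by decide),
      hf (show (1 : Fin 4) < 2 by decide), hf (show (2 : Fin 4) < 3 by decide),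
      h (0 : Fin 4) (1 : Fin 4), h (0 : Fin 4) (2 : Fin 4), h (0 : Fin 4) (3 : Fin 4),
      h (1 : Fin 4) (2 : Fin 4), h (1 : Fin 4) (3 : Fin 4), h (2 : Fin 4) (3 : Fin 4)⟩
  · rintro ⟨i, j, k, l, hij, hjk, hkl, h1, h2, h3, h4, h5, h6⟩
    have hik := hij.trans hjk
    have hjl := hjk.trans hkl
    have hil := hij.trans hjl
    refine ⟨(![i, j, k, l] : Fin 4 → Fin n), ?_, ?_⟩
    · change StrictMono (![i, j, k, l] : Fin 4 → Fin n)
      rw [Fin.strictMono_iff_lt_succ]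
      intro s
      fin_cases s
      exacts [hij, hjk, hkl]
    · intro s t
      change Fin 4 at s t
      fin_cases s <;> fin_cases t
      exacts [iff_of_false (lt_irrefl _) (lt_irrefl _), h1, h2, h3,
        lt_iff_lt_swap hij.ne hab h1, iff_of_false (lt_irrefl _) (lt_irrefl _), h4, h5,
        lt_iff_lt_swap hik.ne hac h2, lt_iff_lt_swap hjk.ne hbc h4,
        iff_of_false (lt_irrefl _) (lt_irrefl _), h6,
        lt_iff_lt_swap hil.ne had h3, lt_iff_lt_swap hjl.ne hbd h5, lt_iff_lt_swap hkl.ne hcd h6,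
        iff_of_false (lt_irrefl _) (lt_irrefl _)]

end Patterns

section Classes

variable {n : ℕ}

/-! ### Pattern classes as permutations monotone on two blocks -/

/-- No entry of `τ` is smaller than an entry before it and an entry after it. -/
def NoValley (τ : Perm (Fin n)) : Prop := ∀ i j k, i < j → j < k → ¬ (τ j < τ i ∧ τ j < τ k)

/-- No entry of `τ` is larger than an entry before it and an entry after it. -/
def NoPeak (τ : Perm (Fin n)) : Prop := ∀ i j k, i < j → j < k → ¬ (τ i < τ j ∧ τ k < τ j)

lemma mem_cyclesAvoiding_valley {τ : Perm (Fin n)} :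
    τ ∈ cyclesAvoiding n [[2, 1, 3], [3, 1, 2]] ↔ τ.IsCycleOn Set.univ ∧ NoValley τ := by
  refine and_congr_right fun _ => ?_
  simp only [List.mem_cons, List.not_mem_nil, or_false, forall_eq_or_imp, forall_eq]
  rw [contains_three (by decide) (by decide) (by decide),
    contains_three (by decide) (by decide) (by decide)]
  norm_num
  constructor
  · rintro ⟨h1, h2⟩ i j k hij hjk ⟨h3, h4⟩
    rcases lt_or_gt_of_ne (τ.injective.ne (hij.trans hjk).ne) with h5 | h5
    · exact (h1 i j hij k hjk h3.le h5).not_gt h4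
    · exact (h2 i j hij k hjk h3.le h5.le).not_gt h4
  · intro h
    refine ⟨fun i j hij k hjk h1 _ => ?_, fun i j hij k hjk h1 _ => ?_⟩ <;>
    exact not_lt.1 fun h2 => h i j k hij hjk ⟨lt_of_le_of_ne h1 (τ.injective.ne hij.ne'), h2⟩

lemma mem_cyclesAvoiding_peak {τ : Perm (Fin n)} :
    τ ∈ cyclesAvoiding n [[1, 3, 2], [2, 3, 1]] ↔ τ.IsCycleOn Set.univ ∧ NoPeak τ := by
  refine and_congr_right fun _ => ?_
  simp only [List.mem_cons, List.not_mem_nil, or_false, forall_eq_or_imp, forall_eq]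
  rw [contains_three (by decide) (by decide) (by decide),
    contains_three (by decide) (by decide) (by decide)]
  norm_num
  constructor
  · rintro ⟨h1, h2⟩ i j k hij hjk ⟨h3, h4⟩
    rcases lt_or_gt_of_ne (τ.injective.ne (hij.trans hjk).ne) with h5 | h5
    · exact (h1 i j hij k hjk h3 h5).not_gt h4
    · exact (h2 i j hij k hjk h3 h5.le).not_gt h4
  · intro h
    refine ⟨fun i j hij k hjk h1 _ => ?_, fun i j hij k hjk h1 _ => ?_⟩ <;>
    exact lt_of_le_of_ne (not_lt.1 fun h2 => h i j k hij hjk ⟨h1, h2⟩) (τ.injective.ne hjk.ne)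

/-- `g` cuts `Fin n` into an initial and a final block, and `h` is increasing on both. -/
def IsIncreasingOnBlocks {α : Type*} [LT α] (h : Fin n → α) (g : Fin n → Bool) : Prop :=
  Monotone g ∧ ∀ i j, i < j → g i = g j → h i < h j

/-- The map `h` avoids the patterns `321`, `2143` and `3142`. -/
def AvoidsTwoDescents {α : Type*} [LT α] (h : Fin n → α) : Prop :=
  (∀ i j k, i < j → j < k → ¬ (h k < h j ∧ h j < h i)) ∧
  (∀ i j k l, i < j → j < k → k < l → ¬ (h j < h i ∧ h i < h l ∧ h l < h k)) ∧
  (∀ i j k l, i < j → j < k → k < l → ¬ (h j < h l ∧ h l < h i ∧ h i < h k))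

section

variable {α : Type*} [LinearOrder α] {h : Fin n → α}

lemma IsIncreasingOnBlocks.avoidsTwoDescents {g : Fin n → Bool} (hg : IsIncreasingOnBlocks h g) :
    AvoidsTwoDescents h := by
  -- Descents only occur across the two blocks.
  have hdesc : ∀ i j, i < j → h j < h i → g i = false ∧ g j = true := fun i j hij hji => by
    have h1 : g i ≠ g j := fun h2 => hji.asymm (hg.2 i j hij h2)
    have h2 := hg.1 hij.le
    revert h1 h2
    cases g i <;> cases g j <;> simp
  refine ⟨fun i j k hij hjk h1 => ?_, fun i j k l hij hjk hkl h1 => ?_,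
    fun i j k l hij hjk hkl h1 => ?_⟩
  · have h2 := (hdesc i j hij h1.2).2
    rw [(hdesc j k hjk h1.1).1] at h2
    exact absurd h2 (by simp)
  all_goals
    have h2 := (hdesc i j hij (by order)).2
    have h3 := (hdesc k l hkl (by order)).1
    have h4 := hg.1 hjk.le
    rw [h2, h3] at h4
    exact absurd h4 (by decide)

/-- The final block consists of the positions at or after the bottom of the first descent. -/
lemma AvoidsTwoDescents.existsUnique (hinj : Injective h) (hmono : ¬ StrictMono h)
    (hav : AvoidsTwoDescents h) : ∃! g, IsIncreasingOnBlocks h g := by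
  classical
  obtain ⟨h1, h2, h3⟩ := hav
  let g : Fin n → Bool := fun i => decide (∃ a b, a < b ∧ b ≤ i ∧ h b < h a)
  have hg : IsIncreasingOnBlocks h g := by
    refine ⟨fun i j hij => ?_, fun i j hij h4 => ?_⟩
    · simp only [g]
      by_cases h5 : ∃ a b, a < b ∧ b ≤ i ∧ h b < h a
      · obtain ⟨a, b, hab, hbi, h6⟩ := h5
        rw [decide_eq_true (⟨a, b, hab, hbi.trans hij, h6⟩ :
          ∃ a b, a < b ∧ b ≤ j ∧ h b < h a)]
        exact Bool.le_true _
      · rw [decide_eq_false h5]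
        exact Bool.false_le _
    · by_contra h5
      have hji : h j < h i := lt_of_le_of_ne (not_lt.1 h5) (hinj.ne hij.ne')
      have hgj : g j = true := decide_eq_true ⟨i, j, hij, le_rfl, hji⟩
      rw [hgj] at h4
      obtain ⟨a, b, hab, hbi, h6⟩ := of_decide_eq_true h4
      rcases hbi.eq_or_lt with rfl | hbi
      · exact h1 a b j hab hij ⟨hji, h6⟩
      -- Two disjoint descents, at `a < b` and at `i < j`, form the pattern `2143` or `3142`.
      · have hai := hab.trans hbi
        have h7 : h a < h i := lt_of_le_of_ne
          (not_lt.1 fun h8 => h1 a i j hai hij ⟨hji, h8⟩) (hinj.ne hai.ne)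
        have h8 : h b < h j := lt_of_le_of_ne
          (not_lt.1 fun h8 => h1 a b j hab (hbi.trans hij) ⟨h8, h6⟩) (hinj.ne (hbi.trans hij).ne)
        rcases lt_or_gt_of_ne (hinj.ne (hai.trans hij).ne) with h9 | h9
        · exact h2 a b i j hab hbi hij ⟨h6, h9, hji⟩
        · exact h3 a b i j hab hbi hij ⟨h8, h9, h7⟩
  refine ⟨g, hg, fun g' hg' => funext fun i => ?_⟩
  by_cases h4 : ∃ a b, a < b ∧ b ≤ i ∧ h b < h a
  · rw [show g i = true from decide_eq_true h4]
    obtain ⟨a, b, hab, hbi, h6⟩ := h4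
    by_contra h5
    have h5' : g' i = false := by simpa using h5
    have hle : ∀ c ≤ i, g' c = false := fun c hc => by
      have := hg'.1 hc
      rw [h5'] at this
      exact le_antisymm this (Bool.false_le _)
    exact h6.asymm (hg'.2 a b hab ((hle a (hab.le.trans hbi)).trans (hle b hbi).symm))
  · rw [show g i = false from decide_eq_false h4]
    by_contra h5
    have h5' : g' i = true := by simpa using h5
    have hge : ∀ c, i ≤ c → g' c = true := fun c hc => by
      have := hg'.1 hc
      rw [h5'] at this
      exact le_antisymm (Bool.le_true _) this
    have hlow : ∀ a b, a < b → b ≤ i → h a < h b := fun a b hab hbi =>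
      lt_of_le_of_ne (not_lt.1 fun h6 => h4 ⟨a, b, hab, hbi, h6⟩) (hinj.ne hab.ne)
    have hhigh : ∀ a b, a < b → i ≤ a → h a < h b := fun a b hab hia =>
      hg'.2 a b hab ((hge a hia).trans (hge b (hia.trans hab.le)).symm)
    refine hmono fun a b hab => ?_
    rcases le_or_gt b i with hbi | hib
    · exact hlow a b hab hbi
    · rcases lt_or_ge a i with hai | hia
      · exact (hlow a i hai le_rfl).trans (hhigh i b hib le_rfl)
      · exact hhigh a b hab hia

end

lemma isSplit_false_iff {τ : Perm (Fin n)} {g : Fin n → Bool} :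
    IsSplit (fun _ => false) τ g ↔ IsIncreasingOnBlocks τ g :=
  ⟨fun h => ⟨h.mono, fun i j hij hg => oriented_false.1 (h.oriented i j hij hg)⟩,
    fun h => ⟨h.1, fun i j hij hg => oriented_false.2 (h.2 i j hij hg)⟩⟩

lemma isSplit_true_iff {τ : Perm (Fin n)} {g : Fin n → Bool} :
    IsSplit (fun _ => true) τ g ↔ IsIncreasingOnBlocks (OrderDual.toDual ∘ τ) g :=
  ⟨fun h => ⟨h.mono, fun i j hij hg =>
      OrderDual.toDual_lt_toDual.2 (oriented_true.1 (h.oriented i j hij hg))⟩,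
    fun h => ⟨h.1, fun i j hij hg =>
      oriented_true.2 (OrderDual.toDual_lt_toDual.1 (h.2 i j hij hg))⟩⟩

lemma mem_cyclesAvoiding_descents {τ : Perm (Fin n)} :
    τ ∈ cyclesAvoiding n [[3, 2, 1], [2, 1, 4, 3], [3, 1, 4, 2]] ↔
      τ.IsCycleOn Set.univ ∧ AvoidsTwoDescents τ := by
  refine and_congr_right fun _ => ?_
  simp only [List.mem_cons, List.not_mem_nil, or_false, forall_eq_or_imp, forall_eq]
  rw [contains_three (by decide) (by decide) (by decide),
    contains_four (by decide) (by decide) (by decide) (by decide) (by decide) (by decide),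
    contains_four (by decide) (by decide) (by decide) (by decide) (by decide) (by decide)]
  have hne : ∀ {i j}, i < j → τ i ≠ τ j := fun hij => τ.injective.ne hij.ne
  refine and_congr ?_ (and_congr ?_ ?_)
  · constructor
    · rintro h i j k hij hjk h1
      refine h ⟨i, j, k, hij, hjk, ?_⟩
      norm_num
      refine ⟨?_, ?_, ?_⟩ <;> order
    · rintro h ⟨i, j, k, hij, hjk, h1⟩
      norm_num at h1
      have h2 := hne hij
      have h3 := hne hjk
      refine h i j k hij hjk ⟨?_, ?_⟩ <;> order
  all_goals
    constructor
    · rintro h i j k l hij hjk hkl h1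
      refine h ⟨i, j, k, l, hij, hjk, hkl, ?_⟩
      norm_num
      refine ⟨?_, ?_, ?_, ?_, ?_, ?_⟩ <;> order
    · rintro h ⟨i, j, k, l, hij, hjk, hkl, h1⟩
      norm_num at h1
      have h2 := hne hij
      have h3 := hne (hij.trans hjk)
      have h4 := hne (hij.trans (hjk.trans hkl))
      have h5 := hne hjk
      have h6 := hne (hjk.trans hkl)
      have h7 := hne hkl
      refine h i j k l hij hjk hkl ⟨?_, ?_, ?_⟩ <;> order

lemma mem_cyclesAvoiding_ascents {τ : Perm (Fin n)} :
    τ ∈ cyclesAvoiding n [[1, 2, 3], [2, 4, 1, 3], [3, 4, 1, 2]] ↔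
      τ.IsCycleOn Set.univ ∧ AvoidsTwoDescents (OrderDual.toDual ∘ τ) := by
  refine and_congr_right fun _ => ?_
  simp only [List.mem_cons, List.not_mem_nil, or_false, forall_eq_or_imp, forall_eq]
  rw [contains_three (by decide) (by decide) (by decide),
    contains_four (by decide) (by decide) (by decide) (by decide) (by decide) (by decide),
    contains_four (by decide) (by decide) (by decide) (by decide) (by decide) (by decide)]
  have hne : ∀ {i j}, i < j → τ i ≠ τ j := fun hij => τ.injective.ne hij.ne
  refine and_congr ?_ (and_comm.trans (and_congr ?_ ?_))
  · constructor
    · rintro h i j k hij hjk h1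
      simp only [comp_apply, OrderDual.toDual_lt_toDual] at h1
      refine h ⟨i, j, k, hij, hjk, ?_⟩
      norm_num
      refine ⟨?_, ?_, ?_⟩ <;> order
    · rintro h ⟨i, j, k, hij, hjk, h1⟩
      norm_num at h1
      refine h i j k hij hjk ?_
      simp only [comp_apply, OrderDual.toDual_lt_toDual]
      refine ⟨?_, ?_⟩ <;> order
  all_goals
    constructor
    · rintro h i j k l hij hjk hkl h1
      simp only [comp_apply, OrderDual.toDual_lt_toDual] at h1
      refine h ⟨i, j, k, l, hij, hjk, hkl, ?_⟩
      norm_num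
      refine ⟨?_, ?_, ?_, ?_, ?_, ?_⟩ <;> order
    · rintro h ⟨i, j, k, l, hij, hjk, hkl, h1⟩
      norm_num at h1
      have h2 := hne hij
      have h3 := hne (hij.trans hjk)
      have h4 := hne (hij.trans (hjk.trans hkl))
      have h5 := hne hjk
      have h6 := hne (hjk.trans hkl)
      have h7 := hne hkl
      refine h i j k l hij hjk hkl ?_
      simp only [comp_apply, OrderDual.toDual_lt_toDual]
      refine ⟨?_, ?_, ?_⟩ <;> order

end Classes

section Enumeration

variable {n : ℕ}

/-! ### From permutations to triples -/

/-- If the labels are determined by the permutation, each permutation accounts for `n` triples, one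
for each marked point. -/
lemma ncard_triples_eq {S : Set (Perm (Fin n) × (Fin n → Bool) × Fin n)} {C : Set (Perm (Fin n))}
    (hS : ∀ T ∈ S, T.1 ∈ C) (hC : ∀ τ ∈ C, ∀ x, ∃! g, (τ, g, x) ∈ S) :
    S.ncard = C.ncard * n := by
  have hinj : Set.InjOn (fun T : Perm (Fin n) × (Fin n → Bool) × Fin n => (T.1, T.2.2)) S := by
    rintro ⟨τ, g, x⟩ hT ⟨τ', g', x'⟩ hT' h
    obtain ⟨rfl, rfl⟩ := Prod.mk.inj h
    rw [(hC τ (hS _ hT) x).unique hT hT']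
  have himage : (fun T : Perm (Fin n) × (Fin n → Bool) × Fin n => (T.1, T.2.2)) '' S =
      C ×ˢ Set.univ := by
    ext ⟨τ, x⟩
    constructor
    · rintro ⟨T, hT, h⟩
      obtain ⟨rfl, rfl⟩ := Prod.mk.inj h
      exact ⟨hS T hT, trivial⟩
    · rintro ⟨hτ, -⟩
      obtain ⟨g, hg, -⟩ := hC τ hτ x
      exact ⟨_, hg, rfl⟩
  rw [← hinj.ncard_image, himage, Set.ncard_prod, Set.ncard_univ, Nat.card_fin]

lemma count_word {T : Perm (Fin n) × (Fin n → Bool) × Fin n} (hT : T.1.IsCycleOn Set.univ)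
    (e : Bool → Bool) : count e (word T) n = ∑ i, (e (T.2.1 i)).toNat := by
  refine Finset.sum_bij (fun t _ => (T.1 ^ t) T.2.2) (fun _ _ => Finset.mem_univ _) ?_ ?_
    fun _ _ => rfl
  · intro s hs t ht hst
    exact ((pow_apply_eq_iff hT _ s t).1 hst).eq_of_lt_of_lt (Finset.mem_range.1 hs)
      (Finset.mem_range.1 ht)
  · intro i _
    obtain ⟨t, rfl⟩ := exists_pow_apply_eq hT T.2.2 i
    exact ⟨t % n, Finset.mem_range.2 (Nat.mod_lt _ T.2.2.pos),
      (pow_apply_eq_iff hT _ _ _).2 (Nat.mod_modEq t n)⟩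

/-- The largest entry of a permutation that increases and then decreases can be put into either
block; one of the two choices makes the number of labels `true` odd. -/
lemma NoValley.existsUnique (hn : 0 < n) {τ : Perm (Fin n)} (hτ : NoValley τ) :
    ∃! g, IsSplit id τ g ∧ Odd (∑ i, (g i).toNat) := by
  have : Nonempty (Fin n) := ⟨⟨0, hn⟩⟩
  obtain ⟨m, hm⟩ := Finite.exists_max τ
  have hm' : ∀ i, i ≠ m → τ i < τ m := fun i hi => lt_of_le_of_ne (hm i) (τ.injective.ne hi)
  let G : Bool → Fin n → Bool := fun b i => if i = m then b else decide (m < i)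
  have hGm : ∀ b, G b m = b := fun b => if_pos rfl
  have hlt : ∀ b i, i < m → G b i = false := fun b i hi => by
    simp [G, hi.ne, hi.le]
  have hgt : ∀ b i, m < i → G b i = true := fun b i hi => by
    simp [G, hi.ne', hi]
  have hsum : ∀ b, ∑ i, (G b i).toNat = b.toNat + ∑ i ∈ Finset.univ.erase m, (G true i).toNat := by
    intro b
    rw [← Finset.add_sum_erase _ _ (Finset.mem_univ m), hGm]
    congr 1
    refine Finset.sum_congr rfl fun i hi => ?_
    simp [G, Finset.ne_of_mem_erase hi]
  set c := ∑ i ∈ Finset.univ.erase m, (G true i).toNat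
  have hsplit : ∀ b, IsSplit id τ (G b) := by
    refine fun b => ⟨fun i j hij => ?_, fun i j hij h0 => ?_⟩
    · rcases lt_trichotomy i m with h | rfl | h
      · rw [hlt b i h]
        exact Bool.false_le _
      · rcases hij.eq_or_lt with rfl | hij
        · exact le_rfl
        · rw [hgt b j hij]
          exact Bool.le_true _
      · rw [hgt b j (h.trans_le hij)]
        exact Bool.le_true _
    · have hinc : j ≤ m → τ i < τ j := fun hj => by
        rcases hj.eq_or_lt with rfl | hj
        · exact hm' i hij.ne
        · exact lt_of_le_of_ne (not_lt.1 fun h => hτ i j m hij hj ⟨h, hm' j hj.ne⟩)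
            (τ.injective.ne hij.ne)
      have hdec : m ≤ i → τ j < τ i := fun hi => by
        rcases hi.eq_or_lt with rfl | hi
        · exact hm' j hij.ne'
        · exact lt_of_le_of_ne (not_lt.1 fun h => hτ m i j hi hij ⟨hm' i hi.ne', h⟩)
            (τ.injective.ne hij.ne')
      cases hc : G b i
      · refine oriented_false.2 (hinc (not_lt.1 fun h => ?_))
        rw [hc, hgt b j h] at h0
        exact absurd h0 (by simp)
      · refine oriented_true.2 (hdec (not_lt.1 fun h => ?_))
        rw [hlt b i h] at hc
        exact absurd hc (by simp)
  -- A position before the maximum cannot be in the decreasing block, nor one after it in the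
  -- increasing block.
  have huniq : ∀ g, IsSplit id τ g → g = G (g m) := fun g hg => funext fun i => by
    rcases lt_trichotomy i m with h | rfl | h
    · rw [hlt _ i h]
      by_contra h1
      have h1 : g i = true := by simpa using h1
      have h2 := hg.mono h.le
      rw [h1] at h2
      have h3 := hg.oriented i m h (h1.trans (le_antisymm h2 (Bool.le_true _)))
      rw [h1] at h3
      exact (oriented_true.1 h3).not_ge (hm i)
    · exact (hGm _).symm
    · rw [hgt _ i h]
      by_contra h1
      have h1 : g i = false := by simpa using h1
      have h2 := hg.mono h.le
      rw [h1] at h2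
      have hgm := le_antisymm h2 (Bool.false_le _)
      have h3 := hg.oriented m i h (hgm.trans h1.symm)
      rw [hgm] at h3
      exact (oriented_false.1 h3).not_ge (hm i)
  have hodd : ∀ b : Bool, Odd (b.toNat + c) ↔ b = decide (Even c) := fun b => by
    by_cases h : Even c
    · cases b <;> simp [h, h.one_add]
    · cases b <;> simp [h, Nat.not_even_iff_odd.1 h, (Nat.not_even_iff_odd.1 h).one_add]
  refine ⟨G (decide (Even c)), ⟨hsplit _, ?_⟩, ?_⟩
  · rw [hsum, hodd]
  · rintro g ⟨hg, ho⟩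
    rw [huniq g hg, hsum, hodd] at ho
    rw [huniq g hg, ho]

lemma IsSplit.noValley {τ : Perm (Fin n)} {g : Fin n → Bool} (h : IsSplit id τ g) :
    NoValley τ := by
  rintro i j k hij hjk ⟨h1, h2⟩
  cases hg : g j
  · have h3 := h.mono hij.le
    rw [hg] at h3
    have hgi := le_antisymm h3 (Bool.false_le _)
    have h4 := h.oriented i j hij (hgi.trans hg.symm)
    rw [hgi] at h4
    exact h1.asymm (oriented_false.1 h4)
  · have h3 := h.mono hjk.le
    rw [hg] at h3
    have h4 := h.oriented j k hjk (hg.trans (le_antisymm h3 (Bool.le_true _)))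
    rw [hg] at h4
    exact h2.asymm (oriented_true.1 h4)

/-! ### The enumerations -/

lemma ncard_valley (hn : 0 < n) :
    (cyclesAvoiding n [[2, 1, 3], [3, 1, 2]]).ncard * n = oddAperiodicCount n := by
  rw [oddAperiodicCount, ← ncard_triples_of_minimalPeriod hn id]
  refine (ncard_triples_eq (fun T hT => ?_) fun τ hτ x => ?_).symm
  · exact mem_cyclesAvoiding_valley.2 ⟨hT.1.1, hT.1.2.noValley⟩
  · obtain ⟨hτ, hv⟩ := mem_cyclesAvoiding_valley.1 hτ
    have hiff : ∀ g : Fin n → Bool, (IsSplit id τ g ∧ Odd (∑ i, (g i).toNat)) ↔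
        (τ, g, x) ∈ {T ∈ triples id n | minimalPeriod shift (word T) = n ∧
          Odd (count id (word T) n)} := fun g => by
      have hcount := count_word (T := (τ, g, x)) hτ id
      refine ⟨fun h => ?_, fun h => ⟨h.1.2, ?_⟩⟩
      · have ho : Odd (count id (word (τ, g, x)) n) := by rw [hcount]; exact h.2
        have hT : (τ, g, x) ∈ triples id n := ⟨hτ, h.1⟩
        exact ⟨hT, minimalPeriod_eq_of_odd hT ho, ho⟩
      · have ho := h.2.2
        rw [hcount] at ho
        exact ho
    exact (existsUnique_congr hiff).1 (hv.existsUnique hn)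

/-- Conjugation by the reversal of `Fin n` reverses both positions and entries. -/
lemma ncard_peak (n : ℕ) : (cyclesAvoiding n [[1, 3, 2], [2, 3, 1]]).ncard =
    (cyclesAvoiding n [[2, 1, 3], [3, 1, 2]]).ncard := by
  let E : Perm (Fin n) → Perm (Fin n) := fun τ => Fin.revPerm * τ * Fin.revPerm⁻¹
  have hE : ∀ τ i, E τ i = Fin.rev (τ (Fin.rev i)) := fun τ i => rfl
  have hinj : Injective E := fun τ τ' h => mul_left_cancel (mul_right_cancel h)
  have hcyc : ∀ τ : Perm (Fin n), τ.IsCycleOn Set.univ → (E τ).IsCycleOn Set.univ := fun τ hτ => by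
    have := hτ.conj (g := Fin.revPerm)
    rwa [Set.image_univ, Equiv.range_eq_univ] at this
  refine le_antisymm (Set.ncard_le_ncard_of_injOn E (fun τ hτ => ?_) hinj.injOn)
    (Set.ncard_le_ncard_of_injOn E (fun τ hτ => ?_) hinj.injOn)
  · obtain ⟨h1, h2⟩ := mem_cyclesAvoiding_peak.1 hτ
    refine mem_cyclesAvoiding_valley.2 ⟨hcyc τ h1, fun i j k hij hjk h => ?_⟩
    simp only [hE, Fin.rev_lt_rev] at h
    exact h2 _ _ _ (Fin.rev_lt_rev.2 hjk) (Fin.rev_lt_rev.2 hij) h.symm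
  · obtain ⟨h1, h2⟩ := mem_cyclesAvoiding_valley.1 hτ
    refine mem_cyclesAvoiding_peak.2 ⟨hcyc τ h1, fun i j k hij hjk h => ?_⟩
    simp only [hE, Fin.rev_lt_rev] at h
    exact h2 _ _ _ (Fin.rev_lt_rev.2 hjk) (Fin.rev_lt_rev.2 hij) h.symm

lemma ncard_descents (hn : 2 ≤ n) :
    (cyclesAvoiding n [[3, 2, 1], [2, 1, 4, 3], [3, 1, 4, 2]]).ncard * n =
      aperiodicCount (fun _ => True) n := by
  rw [← ncard_triples_of_minimalPeriod (by omega) (fun _ => false)]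
  refine (ncard_triples_eq (fun T hT => ?_) fun τ hτ x => ?_).symm
  · exact mem_cyclesAvoiding_descents.2
      ⟨hT.1.1, (isSplit_false_iff.1 hT.1.2).avoidsTwoDescents⟩
  · obtain ⟨hτ, hv⟩ := mem_cyclesAvoiding_descents.1 hτ
    have hmono : ¬ StrictMono τ := fun h => by
      have h1 := congrFun (h.range_inj strictMono_id |>.1 (by simp)) x
      have : Nontrivial (Fin n) := Fin.nontrivial_iff_two_le.2 hn
      exact hτ.apply_ne Set.nontrivial_univ (Set.mem_univ x) h1
    refine (existsUnique_congr fun g => ?_).1 (hv.existsUnique τ.injective hmono)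
    rw [← isSplit_false_iff]
    refine ⟨fun h => ?_, fun h => h.1.2⟩
    have hT : (τ, g, x) ∈ triples (fun _ => false) n := ⟨hτ, h⟩
    exact ⟨hT, minimalPeriod_eq_of_even hT (by simp [count]), trivial⟩

/-- An involution is a cycle on at most two points, hence a cyclic permutation of more points is
not decreasing. -/
lemma not_strictAnti (hn : 3 ≤ n) {τ : Perm (Fin n)} (hτ : τ.IsCycleOn Set.univ) :
    ¬ StrictAnti τ := fun h => by
  have h1 : StrictMono (τ ∘ τ) := h.comp h
  have x : Fin n := ⟨0, by omega⟩
  have h2 := congrFun (h1.range_inj strictMono_id |>.1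
    (by rw [(τ.surjective.comp τ.surjective).range_eq, Set.range_id])) x
  have h3 := Nat.modEq_zero_iff_dvd.1 ((pow_apply_eq_iff hτ x 2 0).1 h2)
  have := Nat.le_of_dvd two_pos h3
  omega

lemma ncard_ascents (hn : 3 ≤ n) :
    (cyclesAvoiding n [[1, 2, 3], [2, 4, 1, 3], [3, 4, 1, 2]]).ncard * n =
      (triples (fun _ => true) n).ncard := by
  refine (ncard_triples_eq (fun T hT => ?_) fun τ hτ x => ?_).symm
  · exact mem_cyclesAvoiding_ascents.2 ⟨hT.1, (isSplit_true_iff.1 hT.2).avoidsTwoDescents⟩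
  · obtain ⟨hτ, hv⟩ := mem_cyclesAvoiding_ascents.1 hτ
    have hmono : ¬ StrictMono (OrderDual.toDual ∘ τ) := fun h =>
      not_strictAnti hn hτ fun i j hij => h hij
    refine (existsUnique_congr fun g => ?_).1
      (hv.existsUnique (OrderDual.toDual.injective.comp τ.injective) hmono)
    rw [← isSplit_true_iff]
    exact ⟨fun h => ⟨hτ, h⟩, fun h => h.2⟩

lemma ncard_triples_true_of_mod_four_ne (hn : 0 < n) (h4 : n % 4 ≠ 2) :
    (triples (fun _ => true) n).ncard = aperiodicCount (fun _ => True) n := by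
  rw [← ncard_triples_of_minimalPeriod hn (fun _ => true)]
  congr 1
  ext T
  refine ⟨fun hT => ⟨hT, ?_, trivial⟩, fun hT => hT.1⟩
  rcases minimalPeriod_eq_or hT with h | h
  · exact h
  · refine minimalPeriod_eq_of_even hT ?_
    rw [count_const_true]
    exact Nat.even_iff.2 (by omega)

lemma ncard_triples_true_of_odd {m : ℕ} (hm : Odd m) :
    (triples (fun _ => true) (2 * m)).ncard =
      aperiodicCount (fun _ => True) (2 * m) + 2 * aperiodicCount (fun _ => True) m := by
  have hpos := hm.pos
  rw [← ncard_triples_of_minimalPeriod (by omega) (fun _ => true), ← ncard_triples_of_square hm,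
    ← Set.ncard_union_eq ?_ (Set.toFinite _) (Set.toFinite _)]
  · congr 1
    ext T
    constructor
    · intro hT
      rcases minimalPeriod_eq_or hT with h | h
      · exact Or.inl ⟨hT, h, trivial⟩
      · exact Or.inr ⟨hT, by omega⟩
    · rintro (hT | hT)
      exacts [hT.1, hT.1]
  · rw [Set.disjoint_left]
    rintro T ⟨-, h1, -⟩ ⟨-, h2⟩
    omega

lemma ncard_ascents_two :
    (cyclesAvoiding 2 [[1, 2, 3], [2, 4, 1, 3], [3, 4, 1, 2]]).ncard = 1 := by
  rw [Set.ncard_eq_one]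
  refine ⟨swap 0 1, Set.eq_singleton_iff_unique_mem.2 ⟨⟨?_, ?_⟩, fun τ hτ => ?_⟩⟩
  · have h := isCycleOn_swap (show (0 : Fin 2) ≠ 1 by decide)
    rwa [show ({0, 1} : Set (Fin 2)) = Set.univ by ext i; fin_cases i <;> simp] at h
  · rintro ρ hρ ⟨f, hf, -⟩
    have h := Fintype.card_le_of_injective f hf.injective
    simp only [List.mem_cons, List.not_mem_nil, or_false] at hρ
    rcases hρ with rfl | rfl | rfl <;> simp at h
  · have h : ∀ i, τ i ≠ i := fun i => hτ.1.apply_ne Set.nontrivial_univ (Set.mem_univ i)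
    revert h
    clear hτ
    revert τ
    decide

end Enumeration

end PatternCycles

theorem theorem4p1 (n : ℕ) (hn : 2 ≤ n) :
    ((PatternCycles.cyclesAvoiding n [[2, 1, 3], [3, 1, 2]]).ncard : ℚ) =
        1 / (2 * (n : ℚ)) * ∑ d ∈ n.divisors with Odd d,
          (ArithmeticFunction.moebius d : ℚ) * 2 ^ (n / d) ∧
    ((PatternCycles.cyclesAvoiding n [[1, 3, 2], [2, 3, 1]]).ncard : ℚ) =
        1 / (2 * (n : ℚ)) * ∑ d ∈ n.divisors with Odd d,
          (ArithmeticFunction.moebius d : ℚ) * 2 ^ (n / d) ∧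
    ((PatternCycles.cyclesAvoiding n [[3, 2, 1], [2, 1, 4, 3], [3, 1, 4, 2]]).ncard : ℚ) =
        1 / (n : ℚ) * ∑ d ∈ n.divisors,
          (ArithmeticFunction.moebius d : ℚ) * 2 ^ (n / d) ∧
    (n = 2 →
      (PatternCycles.cyclesAvoiding n [[1, 2, 3], [2, 4, 1, 3], [3, 4, 1, 2]]).ncard = 1) ∧
    (3 ≤ n → n % 4 ≠ 2 →
      ((PatternCycles.cyclesAvoiding n [[1, 2, 3], [2, 4, 1, 3], [3, 4, 1, 2]]).ncard : ℚ) =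
        1 / (n : ℚ) * ∑ d ∈ n.divisors,
          (ArithmeticFunction.moebius d : ℚ) * 2 ^ (n / d)) ∧
    (3 ≤ n → n % 4 = 2 →
      ((PatternCycles.cyclesAvoiding n [[1, 2, 3], [2, 4, 1, 3], [3, 4, 1, 2]]).ncard : ℚ) =
        1 / (n : ℚ) * ∑ d ∈ n.divisors,
          (ArithmeticFunction.moebius d : ℚ) * 2 ^ (n / d) +
        2 / (n : ℚ) * ∑ d ∈ (n / 2).divisors,
          (ArithmeticFunction.moebius d : ℚ) * 2 ^ (n / (2 * d))) := by
  have hpos : 0 < n := by omega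
  have hn0 : (n : ℚ) ≠ 0 := by positivity
  have hvalley : ((PatternCycles.cyclesAvoiding n [[2, 1, 3], [3, 1, 2]]).ncard : ℚ) =
      1 / (2 * (n : ℚ)) * ∑ d ∈ n.divisors with Odd d,
        (ArithmeticFunction.moebius d : ℚ) * 2 ^ (n / d) := by
    rw [← PatternCycles.two_mul_oddAperiodicCount_eq hpos, ← PatternCycles.ncard_valley hpos]
    push_cast
    field_simp
  refine ⟨hvalley, by rw [PatternCycles.ncard_peak, hvalley], ?_, ?_, fun h3 h4 => ?_,
    fun h3 h4 => ?_⟩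
  · rw [← PatternCycles.aperiodicCount_eq hpos, ← PatternCycles.ncard_descents hn]
    push_cast
    field_simp
  · rintro rfl
    exact PatternCycles.ncard_ascents_two
  · rw [← PatternCycles.aperiodicCount_eq hpos,
      ← PatternCycles.ncard_triples_true_of_mod_four_ne hpos h4, ← PatternCycles.ncard_ascents h3]
    push_cast
    field_simp
  · obtain ⟨m, rfl⟩ : ∃ m, n = 2 * m := ⟨n / 2, by omega⟩
    have hm : Odd m := Nat.odd_iff.2 (by omega)
    have hcard := (PatternCycles.ncard_ascents h3).trans
      (PatternCycles.ncard_triples_true_of_odd hm)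
    have hcardQ : ((PatternCycles.cyclesAvoiding (2 * m)
        [[1, 2, 3], [2, 4, 1, 3], [3, 4, 1, 2]]).ncard : ℚ) * (2 * m : ℕ) =
        PatternCycles.aperiodicCount (fun _ => True) (2 * m) +
          2 * PatternCycles.aperiodicCount (fun _ => True) m := by
      exact_mod_cast hcard
    have hdiv : ∀ d, 2 * m / (2 * d) = m / d := fun d => Nat.mul_div_mul_left m d two_pos
    simp only [hdiv, Nat.mul_div_cancel_left m two_pos]
    rw [← PatternCycles.aperiodicCount_eq hpos, ← PatternCycles.aperiodicCount_eq hm.pos,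
      div_mul_eq_mul_div, div_mul_eq_mul_div, one_mul, ← add_div, eq_div_iff hn0, hcardQ]
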